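/- Let $S\subset\mathbb R^d$ be a smooth ($C^\infty$) embedded submanifold without boundary, of any dimension $k$, and let $\Omega\subset\mathbb R^d$ be an open neighbourhood of $S$ such that every $x\in\Omega$ has a unique closest point $\mathrm{cp}(x)$ in $S$. Let $\varepsilon>0$. Write $\Delta_S=\nabla_S\cdot\nabla_S$ for the Laplace--Beltrami operator of $S$, $\Delta$ for the Laplacian of $\mathbb R^d$, and, for $v:\Omega\to\mathbb R$ such that $v\circ\mathrm{cp}$ is $C^2$ on $\Omega$, $$\Delta^{\#}_\varepsilon v(x)=\Delta(v\circ\mathrm{cp})(x)-\frac{2d}{\varepsilon^2}\bigl[v(x)-v(\mathrm{cp}(x))\bigr],\qquad x\in\Omega .$$ A Laplace--Beltrami eigenfunction with eigenvalue $\lambda\in\mathbb R$ is a $u\in C^2(S)$, $u\not\equiv 0$, with $-\Delta_S u=\lambda u$ on $S$; an eigenfunction of the regularized embedded problem with eigenvalue $\lambda\in\mathbb R$ is a $v:\Omega\to\mathbb R$, $v\not\equiv0$, with $v\circ\mathrm{cp}\in C^2(\Omega)$ and $-\Delta^{\#}_\varepsilon v=\lambda v$ on $\Omega$. (1) For every Laplace--Beltrami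 eigenfunction $u$ with eigenvalue $\lambda<\frac{2d}{\varepsilon^2}$ there is a unique eigenfunction $v:\Omega\to\mathbb R$ of the regularized embedded problem with eigenvalue $\lambda$ which agrees with $u$ on $S$. It is given by $$v(x)=\frac{\Delta(u\circ\mathrm{cp})(x)+\frac{2d}{\varepsilon^2}\,u(\mathrm{cp}(x))}{-\lambda+\frac{2d}{\varepsilon^2}},\qquad x\in\Omega .$$ (2) Conversely, for every eigenfunction $v$ of the regularized embedded problem with eigenvalue $\lambda$, the restriction $v|_S$ is of class $C^2$ and satisfies $-\Delta_S(v|_S)=\lambda\,v|_S$ on $S$; if $\lambda\neq\frac{2d}{\varepsilon^2}$, then $v|_S\not\equiv0$, so that $v|_S$ is a Laplace--Beltrami eigenfunction with eigenvalue $\lambda$. -/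

import Mathlib

open scoped ContDiff Laplacian

noncomputable section

namespace ClosestPointMethod

/-- `p` is a closest point of `S` to `x`. -/
def IsClosestPoint {d : ℕ} (S : Set (EuclideanSpace ℝ (Fin d)))
    (x p : EuclideanSpace ℝ (Fin d)) : Prop :=
  p ∈ S ∧ ∀ q ∈ S, dist x p ≤ dist x q

/-- The closest point function `cp` of `S`: a closest point of `S` to `x` (whenever one exists). -/
def cp {d : ℕ} (S : Set (EuclideanSpace ℝ (Fin d)))
    (x : EuclideanSpace ℝ (Fin d)) : EuclideanSpace ℝ (Fin d) :=
  Classical.epsilon (IsClosestPoint S x)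

/-- `Ω` is a neighbourhood of `S` on which the closest point function is well defined. -/
structure IsClosestPointNhd {d : ℕ} (S Ω : Set (EuclideanSpace ℝ (Fin d))) : Prop where
  isOpen : IsOpen Ω
  subset : S ⊆ Ω
  existsUnique : ∀ x ∈ Ω, ∃! p, IsClosestPoint S x p

/-- `φ`, defined on the open set `U ⊆ ℝᵏ`, is a smooth regular local parametrization of a relatively
open piece of `S ⊆ ℝᵈ`. -/
structure IsLocalParam {d k : ℕ} (S : Set (EuclideanSpace ℝ (Fin d)))
    (U : Set (EuclideanSpace ℝ (Fin k)))
    (φ : EuclideanSpace ℝ (Fin k) → EuclideanSpace ℝ (Fin d)) : Prop where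
  isOpen : IsOpen U
  contDiffOn : ContDiffOn ℝ ∞ φ U
  injective_fderiv : ∀ y ∈ U, Function.Injective (fderiv ℝ φ y)
  isEmbedding : Topology.IsEmbedding (U.domRestrict φ)
  image_eq : ∃ V, IsOpen V ∧ φ '' U = S ∩ V

/-- `S` is a smooth `k`-dimensional surface (embedded submanifold without boundary) in `ℝᵈ`. -/
def IsSmoothSurface {d : ℕ} (k : ℕ) (S : Set (EuclideanSpace ℝ (Fin d))) : Prop :=
  ∀ p ∈ S, ∃ (U : Set (EuclideanSpace ℝ (Fin k)))
    (φ : EuclideanSpace ℝ (Fin k) → EuclideanSpace ℝ (Fin d)),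
    IsLocalParam S U φ ∧ p ∈ φ '' U

/-- Partial derivative `∂ᵢ F` of a map on `ℝᵏ`. -/
def partialDeriv {k : ℕ} {X : Type*} [NormedAddCommGroup X] [NormedSpace ℝ X]
    (i : Fin k) (F : EuclideanSpace ℝ (Fin k) → X) (y : EuclideanSpace ℝ (Fin k)) : X :=
  fderiv ℝ F y (EuclideanSpace.single i 1)

/-- The first fundamental form `gᵢⱼ = ⟨∂ᵢφ, ∂ⱼφ⟩`. -/
def metricMatrix {d k : ℕ} (φ : EuclideanSpace ℝ (Fin k) → EuclideanSpace ℝ (Fin d))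
    (y : EuclideanSpace ℝ (Fin k)) : Matrix (Fin k) (Fin k) ℝ :=
  Matrix.of fun i j => inner ℝ (partialDeriv i φ y) (partialDeriv j φ y)

/-- The surface gradient `∇_S u = ∑ gⁱʲ ∂ⱼ(u ∘ φ) ∂ᵢφ` at `φ y`, a tangent vector in `ℝᵈ`. -/
def surfaceGradient {d k : ℕ} (φ : EuclideanSpace ℝ (Fin k) → EuclideanSpace ℝ (Fin d))
    (u : EuclideanSpace ℝ (Fin d) → ℝ) (y : EuclideanSpace ℝ (Fin k)) :
    EuclideanSpace ℝ (Fin d) :=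
  ∑ i, ∑ j, ((metricMatrix φ y)⁻¹ i j * partialDeriv j (u ∘ φ) y) • partialDeriv i φ y

/-- The surface divergence `∇_S · F = ∑ gⁱʲ ⟨∂ᵢF, ∂ⱼφ⟩` at `φ y` of a vector field along the surface,
written in the parameter as `F : ℝᵏ → ℝᵈ`. -/
def surfaceDivergence {d k : ℕ} (φ : EuclideanSpace ℝ (Fin k) → EuclideanSpace ℝ (Fin d))
    (F : EuclideanSpace ℝ (Fin k) → EuclideanSpace ℝ (Fin d))
    (y : EuclideanSpace ℝ (Fin k)) : ℝ :=
  ∑ i, ∑ j, (metricMatrix φ y)⁻¹ i j * inner ℝ (partialDeriv i F y) (partialDeriv j φ y)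

/-- The Laplace-Beltrami operator `Δ_S u = ∇_S · ∇_S u` at the point `φ y`. -/
def laplaceBeltrami {d k : ℕ} (φ : EuclideanSpace ℝ (Fin k) → EuclideanSpace ℝ (Fin d))
    (u : EuclideanSpace ℝ (Fin d) → ℝ) (y : EuclideanSpace ℝ (Fin k)) : ℝ :=
  surfaceDivergence φ (surfaceGradient φ u) y

/-- `u ∈ C²(S)`. Only the values of `u` on `S` matter, here and below. -/
def IsC2On {d : ℕ} (k : ℕ) (S : Set (EuclideanSpace ℝ (Fin d)))
    (u : EuclideanSpace ℝ (Fin d) → ℝ) : Prop :=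
  ∀ (U : Set (EuclideanSpace ℝ (Fin k)))
    (φ : EuclideanSpace ℝ (Fin k) → EuclideanSpace ℝ (Fin d)),
    IsLocalParam S U φ → ContDiffOn ℝ 2 (u ∘ φ) U

/-- `u ∈ C²(S)` and `-Δ_S u = lam u` on `S`. -/
structure IsLBSolution {d : ℕ} (k : ℕ) (S : Set (EuclideanSpace ℝ (Fin d))) (lam : ℝ)
    (u : EuclideanSpace ℝ (Fin d) → ℝ) : Prop where
  isC2On : IsC2On k S u
  eq : ∀ (U : Set (EuclideanSpace ℝ (Fin k)))
    (φ : EuclideanSpace ℝ (Fin k) → EuclideanSpace ℝ (Fin d)),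
    IsLocalParam S U φ → ∀ y ∈ U, -laplaceBeltrami φ u y = lam * u (φ y)

/-- `u` is an eigenfunction of `-Δ_S` on `S` with eigenvalue `lam`. -/
structure IsLBEigenfunction {d : ℕ} (k : ℕ) (S : Set (EuclideanSpace ℝ (Fin d))) (lam : ℝ)
    (u : EuclideanSpace ℝ (Fin d) → ℝ) : Prop extends IsLBSolution k S lam u where
  ne_zero : ∃ x ∈ S, u x ≠ 0

/-- The regularized operator
`Δ^#_ε v (x) = Δ(v ∘ cp)(x) - (2d/ε²) (v x - v (cp x))`. -/
def lapSharp {d : ℕ} (S : Set (EuclideanSpace ℝ (Fin d))) (ε : ℝ)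
    (v : EuclideanSpace ℝ (Fin d) → ℝ) (x : EuclideanSpace ℝ (Fin d)) : ℝ :=
  Δ (v ∘ cp S) x - 2 * (d : ℝ) / ε ^ 2 * (v x - v (cp S x))

/-- `v` is an eigenfunction of `-Δ^#_ε` on `Ω` with eigenvalue `lam`. The closest point extension
`v ∘ cp` has to be `C²`, so that its Laplacian makes sense classically; `v` itself need not be.
Only the values of `v` on `Ω ⊇ S` matter. -/
structure IsRegEigenfunction {d : ℕ} (S Ω : Set (EuclideanSpace ℝ (Fin d))) (ε lam : ℝ)
    (v : EuclideanSpace ℝ (Fin d) → ℝ) : Prop where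
  contDiffOn : ContDiffOn ℝ 2 (v ∘ cp S) Ω
  eq : ∀ x ∈ Ω, -lapSharp S ε v x = lam * v x
  ne_zero : ∃ x ∈ Ω, v x ≠ 0

end ClosestPointMethod

end

/-!
The theorem reduces to two facts about the closest point function `cp` of `S`.

*Smoothness of `cp` on all of `Ω`* (`IsClosestPointNhd.exists_contDiffAt_coordinate`). In a local
parametrization `φ`, the closest point to `x` has a parameter `y` solving the normal equation
`⟪φ y - x, Dφ y ·⟫ = 0`, and the implicit function theorem applies as soon as the Hessian in `y` of
`½ ‖φ y - x‖²` is nondegenerate. At a minimum it is positive semidefinite. It is positive definite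
because the segment from `cp x` to `x` extends beyond `x` to some `x₁` with the same closest point
(`IsClosestPointNhd.exists_prolongation`), and the Hessian is affine in `x` along that segment,
starting from the first fundamental form. The prolongation is where openness of `Ω` and uniqueness of
closest points enter; `x₁` comes from a maximization that only uses continuity of `cp`.
Since `S` need not be closed, continuity requires first that closest points in the closure of `S`
lie in `S` (`IsClosestPointNhd.eq_cp_of_mem_closure`).

*`Δ (u ∘ cp) = Δ_S u` on `S`* (`IsClosestPointNhd.laplacian_eq_laplaceBeltrami`). The extension
`u ∘ cp` is constant along normal lines near `S`, so along `S` its gradient is tangential, hence is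
the surface gradient, and its Hessian vanishes on normal vectors, so that the full trace is the
tangential trace.

Given these, `u ∘ cp` is `C²` on `Ω` exactly when `u` is `C²` on `S`, the regularized equation on `S`
is the Laplace-Beltrami equation, and at a point `x` of `Ω` it is a linear equation for `v x` with
coefficient `2d/ε² - lam` whose other terms only involve `v` on `S`.
-/

namespace ClosestPointMethod

open Filter Topology Metric Set

/-! ### Closest points -/

section Metric

variable {d : ℕ} {S Ω : Set (EuclideanSpace ℝ (Fin d))} {x p q : EuclideanSpace ℝ (Fin d)}

lemma IsClosestPointNhd.isClosestPoint_cp (hΩ : IsClosestPointNhd S Ω) (hx : x ∈ Ω) :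
    IsClosestPoint S x (cp S x) :=
  Classical.epsilon_spec (hΩ.existsUnique x hx).exists

lemma IsClosestPointNhd.eq_cp (hΩ : IsClosestPointNhd S Ω) (hx : x ∈ Ω)
    (hp : IsClosestPoint S x p) : p = cp S x :=
  (hΩ.existsUnique x hx).unique hp (hΩ.isClosestPoint_cp hx)

lemma IsClosestPointNhd.cp_mem (hΩ : IsClosestPointNhd S Ω) (hx : x ∈ Ω) : cp S x ∈ S :=
  (hΩ.isClosestPoint_cp hx).1

lemma IsClosestPointNhd.cp_of_mem (hΩ : IsClosestPointNhd S Ω) (hx : x ∈ S) : cp S x = x :=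
  (hΩ.eq_cp (hΩ.subset hx) ⟨hx, fun q _ => by simp⟩).symm

lemma IsClosestPoint.dist_le_of_mem_closure (hp : IsClosestPoint S x p) (hq : q ∈ closure S) :
    dist x p ≤ dist x q :=
  closure_minimal (t := {q | dist x p ≤ dist x q}) hp.2
    (isClosed_le continuous_const (by fun_prop)) hq

/-- A closest point of `x` is also a closest point of every point of the segment from `x` to it. -/
lemma IsClosestPoint.segment (hp : IsClosestPoint S x p) {t : ℝ} (ht0 : 0 ≤ t) (ht1 : t ≤ 1) :
    IsClosestPoint S ((1 - t) • x + t • p) p := by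
  refine ⟨hp.1, fun s hs => ?_⟩
  have h1 : dist ((1 - t) • x + t • p) p = (1 - t) * dist x p := by
    rw [dist_eq_norm, dist_eq_norm,
      show (1 - t) • x + t • p - p = (1 - t) • (x - p) by module, norm_smul,
      Real.norm_of_nonneg (sub_nonneg.2 ht1)]
  have h2 : dist x ((1 - t) • x + t • p) = t * dist x p := by
    rw [dist_eq_norm, dist_eq_norm,
      show x - ((1 - t) • x + t • p) = t • (x - p) by module, norm_smul, Real.norm_of_nonneg ht0]
  have := dist_triangle x ((1 - t) • x + t • p) s
  have := hp.2 s hs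
  linarith

/-- Closest points in `closure S` are already closest points in `S`: moving `x` slightly towards a
closest point `q` of the closure makes `q` the only candidate, and the moved point, which is still
in `Ω`, has a closest point in `S`. -/
lemma IsClosestPointNhd.eq_cp_of_mem_closure (hΩ : IsClosestPointNhd S Ω) (hx : x ∈ Ω)
    (hq : q ∈ closure S) (hmin : ∀ s ∈ S, dist x q ≤ dist x s) : q = cp S x := by
  suffices hqS : q ∈ S from hΩ.eq_cp hx ⟨hqS, hmin⟩
  have hlim : ∀ᶠ t : ℝ in 𝓝 0, x + t • (q - x) ∈ Ω := by
    have hc : Continuous fun t : ℝ => x + t • (q - x) := by fun_prop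
    exact hc.continuousAt.eventually_mem (hΩ.isOpen.mem_nhds (by simpa using hx))
  have hlim' : ∀ᶠ t : ℝ in 𝓝[>] 0, x + t • (q - x) ∈ Ω ∧ 0 < t ∧ t < 1 := by
    filter_upwards [nhdsWithin_le_nhds hlim, self_mem_nhdsWithin,
      nhdsWithin_le_nhds (Iio_mem_nhds (zero_lt_one' ℝ))] with t h1 h2 h3 using ⟨h1, h2, h3⟩
  obtain ⟨t, htΩ, ht0, ht1⟩ := hlim'.exists
  have hp := hΩ.isClosestPoint_cp htΩ
  set p := cp S (x + t • (q - x)) with hpdef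
  have h1 : ‖q - x‖ ≤ ‖p - x‖ := by
    simpa only [dist_comm x, dist_eq_norm] using hmin p hp.1
  have h2 : ‖(p - x) - t • (q - x)‖ ≤ ‖(1 - t) • (q - x)‖ := by
    have := hp.dist_le_of_mem_closure hq
    rw [dist_comm _ p, dist_comm _ q, dist_eq_norm, dist_eq_norm] at this
    rwa [show p - x - t • (q - x) = p - (x + t • (q - x)) by module,
      show (1 - t) • (q - x) = q - (x + t • (q - x)) by module]
  have h3 := mul_self_le_mul_self (norm_nonneg _) h2
  have h4 := mul_self_le_mul_self (norm_nonneg _) h1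
  rw [← real_inner_self_eq_norm_mul_norm, ← real_inner_self_eq_norm_mul_norm] at h3 h4
  have h5 : inner ℝ ((p - x) - (q - x)) ((p - x) - (q - x)) ≤ 0 := by
    simp only [inner_sub_left _ (t • _), inner_sub_left _ (q - x), inner_sub_right _ _ (t • _),
      inner_sub_right _ _ (q - x), real_inner_smul_left, real_inner_smul_right] at h3 ⊢
    rw [real_inner_comm (p - x) (q - x)] at h3 ⊢
    nlinarith
  have h6 : (p - x) - (q - x) = 0 := real_inner_self_nonpos.1 h5
  have h7 : q = p := by
    rw [sub_sub_sub_cancel_right, sub_eq_zero] at h6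
    exact h6.symm
  exact h7 ▸ hp.1

lemma IsClosestPointNhd.continuousAt_cp (hΩ : IsClosestPointNhd S Ω) (hx : x ∈ Ω) :
    ContinuousAt (cp S) x := by
  have hΩx := hΩ.isOpen.mem_nhds hx
  refine tendsto_iff_ultrafilter _ _ _ |>.2 fun g hg => ?_
  have hgΩ : ∀ᶠ z in (g : Filter _), z ∈ Ω := hg hΩx
  have hgx : Tendsto id (g : Filter (EuclideanSpace ℝ (Fin d))) (𝓝 x) := hg
  have hle : ∀ s ∈ S, ∀ᶠ z in (g : Filter _), dist z (cp S z) ≤ dist z s := fun s hs =>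
    hgΩ.mono fun z hz => (hΩ.isClosestPoint_cp hz).2 s hs
  have hbdd : ∀ᶠ z in (g : Filter _), cp S z ∈ closedBall x (dist x (cp S x) + 3) := by
    filter_upwards [hle _ (hΩ.cp_mem hx), hgx (ball_mem_nhds x one_pos)] with z h1 h2
    have h2 : dist z x < 1 := h2
    rw [mem_closedBall, dist_comm]
    have := dist_triangle x z (cp S z)
    have := dist_triangle z x (cp S x)
    rw [dist_comm x z] at *
    linarith
  obtain ⟨q, -, hq⟩ := (isCompact_closedBall x (dist x (cp S x) + 3)).ultrafilter_le_nhds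
    (g.map (cp S)) (le_principal_iff.2 hbdd)
  have hq : Tendsto (cp S) g (𝓝 q) := hq
  have hqS : q ∈ closure S :=
    mem_closure_of_tendsto hq (hgΩ.mono fun z hz => hΩ.cp_mem hz)
  have hqmin : ∀ s ∈ S, dist x q ≤ dist x s := fun s hs =>
    le_of_tendsto_of_tendsto (hgx.dist hq) (hgx.dist tendsto_const_nhds) (hle s hs)
  rwa [← hΩ.eq_cp_of_mem_closure hx hqS hqmin]

/-- Since `Ω` is open, the segment from `cp x` to `x` can be prolonged beyond `x` to a point `x₁` that
still has `cp x` as a closest point. The point `x₁` is a maximizer of `δ dist(·, S)² - dist(·, x)²`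
over a small ball, where `δ` is small: the maximizer is interior, and comparing its value with the
values at nearby points `z` (whose closest points converge by continuity of `cp`) gives the
first-order condition `x₁ - x = δ (x₁ - cp x₁)`. -/
lemma IsClosestPointNhd.exists_prolongation (hΩ : IsClosestPointNhd S Ω) (hx : x ∈ Ω) :
    ∃ δ : ℝ, 0 < δ ∧ δ < 1 ∧ ∃ x₁, IsClosestPoint S x₁ (cp S x) ∧
      x = (1 - δ) • x₁ + δ • cp S x := by
  obtain ⟨ρ, hρ, hball⟩ := nhds_basis_closedBall.mem_iff.1 (hΩ.isOpen.mem_nhds hx)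
  set r := dist x (cp S x) with hr
  have hr0 : 0 ≤ r := dist_nonneg
  obtain ⟨δ, hδ0, hδ1, hδ⟩ : ∃ δ : ℝ, 0 < δ ∧ δ < 1 ∧ δ * (r + ρ) ^ 2 < ρ ^ 2 + δ * r ^ 2 := by
    have h1 : ∀ᶠ δ : ℝ in 𝓝[>] 0, δ * (r + ρ) ^ 2 < ρ ^ 2 + δ * r ^ 2 := by
      refine nhdsWithin_le_nhds (ContinuousAt.eventually_lt (by fun_prop) (by fun_prop) ?_)
      simp only [zero_mul, add_zero]
      positivity
    obtain ⟨δ, h⟩ := (h1.and ((eventually_mem_nhdsWithin (s := Ioi (0 : ℝ))).and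
      (nhdsWithin_le_nhds (Iio_mem_nhds (zero_lt_one' ℝ))))).exists
    exact ⟨δ, h.2.1, h.2.2, h.1⟩
  have hcont : ContinuousOn (fun z => δ * dist z (cp S z) ^ 2 - dist z x ^ 2) (closedBall x ρ) := by
    intro z hz
    have := hΩ.continuousAt_cp (hball hz)
    exact ContinuousAt.continuousWithinAt (by fun_prop)
  obtain ⟨x₁, hx₁, hmax⟩ := (isCompact_closedBall x ρ).exists_isMaxOn
    ⟨x, mem_closedBall_self hρ.le⟩ hcont
  have hx₁Ω := hball hx₁
  have hcp₁ := hΩ.isClosestPoint_cp hx₁Ω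
  have hint : dist x₁ x < ρ := by
    refine lt_of_le_of_ne hx₁ fun heq => ?_
    have h1 : δ * r ^ 2 ≤ δ * dist x₁ (cp S x₁) ^ 2 - ρ ^ 2 := by
      simpa [heq, ← hr] using hmax (mem_closedBall_self hρ.le)
    have h2 : dist x₁ (cp S x₁) ≤ r + ρ := by
      have := hcp₁.2 _ (hΩ.cp_mem hx)
      have := dist_triangle x₁ x (cp S x)
      linarith
    have h3 : dist x₁ (cp S x₁) ^ 2 ≤ (r + ρ) ^ 2 := by gcongr
    nlinarith
  have key : ∀ w, inner ℝ w (δ • (x₁ - cp S x₁) - (x₁ - x)) ≤ 0 := by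
    intro w
    have hline : Continuous fun τ : ℝ => x₁ + τ • w := by fun_prop
    have hline0 : Tendsto (fun τ : ℝ => x₁ + τ • w) (𝓝[>] 0) (𝓝 x₁) := by
      simpa using (hline.tendsto 0).mono_left nhdsWithin_le_nhds
    have hev : ∀ᶠ τ : ℝ in 𝓝[>] 0,
        δ * (2 * inner ℝ w (x₁ - cp S (x₁ + τ • w)) + τ * ‖w‖ ^ 2)
          ≤ 2 * inner ℝ w (x₁ - x) + τ * ‖w‖ ^ 2 := by
      filter_upwards [hline0 (isOpen_ball.mem_nhds hint), self_mem_nhdsWithin] with τ h1 h2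
      have hτ : 0 < τ := h2
      have hz : x₁ + τ • w ∈ closedBall x ρ := ball_subset_closedBall h1
      have hm := hmax hz
      have hle : dist x₁ (cp S x₁) ≤ dist x₁ (cp S (x₁ + τ • w)) :=
        hcp₁.2 _ (hΩ.cp_mem (hball hz))
      have hle2 : dist x₁ (cp S x₁) ^ 2 ≤ dist x₁ (cp S (x₁ + τ • w)) ^ 2 := by gcongr
      set q := cp S (x₁ + τ • w)
      have e : ∀ b : EuclideanSpace ℝ (Fin d),
          dist (x₁ + τ • w) b ^ 2 = dist x₁ b ^ 2 + τ * (2 * inner ℝ w (x₁ - b) + τ * ‖w‖ ^ 2) := by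
        intro b
        rw [dist_eq_norm, dist_eq_norm, show x₁ + τ • w - b = (x₁ - b) + τ • w by module,
          norm_add_sq_real, real_inner_smul_right, norm_smul, Real.norm_of_nonneg hτ.le,
          real_inner_comm]
        ring
      simp only [mem_ofPred_eq, e] at hm
      have h3 : τ * (δ * (2 * inner ℝ w (x₁ - q) + τ * ‖w‖ ^ 2))
          ≤ τ * (2 * inner ℝ w (x₁ - x) + τ * ‖w‖ ^ 2) := by nlinarith
      exact le_of_mul_le_mul_left h3 hτ
    have hcp : Tendsto (fun τ : ℝ => cp S (x₁ + τ • w)) (𝓝[>] 0) (𝓝 (cp S x₁)) :=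
      (hΩ.continuousAt_cp hx₁Ω).tendsto.comp hline0
    have hτ0 : Tendsto (fun τ : ℝ => τ) (𝓝[>] 0) (𝓝 0) := nhdsWithin_le_nhds
    have hlim := le_of_tendsto_of_tendsto
      ((((tendsto_const_nhds (x := w)).inner (tendsto_const_nhds.sub hcp)).const_mul 2
        |>.add (hτ0.mul_const (‖w‖ ^ 2))).const_mul δ)
      (tendsto_const_nhds.add (hτ0.mul_const (‖w‖ ^ 2))) hev
    rw [inner_sub_right, real_inner_smul_right]
    linarith
  have hfoc : δ • (x₁ - cp S x₁) - (x₁ - x) = 0 := real_inner_self_nonpos.1 (key _)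
  have hx' : x = (1 - δ) • x₁ + δ • cp S x₁ := by
    rw [← sub_eq_zero, ← hfoc]
    module
  have hcp : cp S x₁ = cp S x :=
    hΩ.eq_cp hx (by simpa only [← hx'] using hcp₁.segment hδ0.le hδ1.le)
  exact ⟨δ, hδ0, hδ1, x₁, hcp ▸ hcp₁, hcp ▸ hx'⟩

end Metric

/-! ### Second derivatives along lines -/

section Lines

variable {E : Type*} [NormedAddCommGroup E] [NormedSpace ℝ E] {G : E → ℝ} {a : E}

lemma tendsto_line (a v : E) : Tendsto (fun t : ℝ => a + t • v) (𝓝 0) (𝓝 a) := by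
  have h : Continuous fun t : ℝ => a + t • v := by fun_prop
  simpa using h.tendsto 0

lemma deriv_line_eventuallyEq (hG : ContDiffAt ℝ 2 G a) (v : E) :
    deriv (fun t : ℝ => G (a + t • v)) =ᶠ[𝓝 0] fun t => fderiv ℝ G (a + t • v) v := by
  have h1 : ∀ᶠ z in 𝓝 a, ContDiffAt ℝ 2 G z := hG.eventually (by simp)
  filter_upwards [(tendsto_line a v).eventually h1] with t ht
  have hl : HasDerivAt (fun t : ℝ => a + t • v) v t := by
    simpa using ((hasDerivAt_id t).smul_const v).const_add a
  exact ((ht.differentiableAt (by norm_num)).hasFDerivAt.comp_hasDerivAt t hl).deriv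

lemma deriv_deriv_line (hG : ContDiffAt ℝ 2 G a) (v : E) :
    deriv (deriv fun t : ℝ => G (a + t • v)) 0 = fderiv ℝ (fderiv ℝ G) a v v := by
  rw [(deriv_line_eventuallyEq hG v).deriv_eq]
  have hl : HasDerivAt (fun t : ℝ => a + t • v) v 0 := by
    simpa using ((hasDerivAt_id (0 : ℝ)).smul_const v).const_add a
  have h2 : HasFDerivAt (fderiv ℝ G) (fderiv ℝ (fderiv ℝ G) a) (a + (0 : ℝ) • v) := by
    simpa using ((hG.fderiv_right (m := 1) (by norm_num)).differentiableAt
      (by norm_num)).hasFDerivAt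
  have h3 : HasDerivAt (fun t : ℝ => fderiv ℝ G (a + t • v)) (fderiv ℝ (fderiv ℝ G) a v) 0 :=
    h2.comp_hasDerivAt (f := fun t : ℝ => a + t • v) 0 hl
  simpa using (h3.clm_apply (hasDerivAt_const 0 v)).deriv

lemma fderiv_apply_eq_zero_of_line (hG : ContDiffAt ℝ 2 G a) {v : E}
    (h : ∀ᶠ t : ℝ in 𝓝 0, G (a + t • v) = G a) : fderiv ℝ G a v = 0 := by
  have h1 := (deriv_line_eventuallyEq hG v).self_of_nhds
  have h2 : (fun t : ℝ => G (a + t • v)) =ᶠ[𝓝 0] fun _ => G a := h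
  rw [h2.deriv_eq, deriv_const] at h1
  simpa using h1.symm

lemma fderiv_fderiv_apply_eq_zero_of_line (hG : ContDiffAt ℝ 2 G a) {v : E}
    (h : ∀ᶠ t : ℝ in 𝓝 0, G (a + t • v) = G a) : fderiv ℝ (fderiv ℝ G) a v v = 0 := by
  have h2 : (fun t : ℝ => G (a + t • v)) =ᶠ[𝓝 0] fun _ => G a := h
  rw [← deriv_deriv_line hG, h2.deriv.deriv_eq]
  simp

/-- The necessary second-order condition. A negative second derivative along a line would make the
restriction to that line have a maximum as well, hence be locally constant. -/
lemma fderiv_fderiv_nonneg_of_isLocalMin (hG : ContDiffAt ℝ 2 G a) (hmin : IsLocalMin G a) (v : E) :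
    0 ≤ fderiv ℝ (fderiv ℝ G) a v v := by
  by_contra! hneg
  have hmin' : IsLocalMin (fun t : ℝ => G (a + t • v)) 0 := by
    have := (tendsto_line a v).eventually hmin
    simpa [IsLocalMin, IsMinFilter] using this
  have hc : ContinuousAt (fun t : ℝ => G (a + t • v)) 0 := by
    have : ContinuousAt G (a + (0 : ℝ) • v) := by simpa using hG.continuousAt
    exact this.comp (f := fun t : ℝ => a + t • v) (by fun_prop)
  have hmax := isLocalMax_of_deriv_deriv_neg
    ((deriv_deriv_line hG v).trans_lt hneg) hmin'.deriv_eq_zero hc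
  refine hneg.ne (fderiv_fderiv_apply_eq_zero_of_line hG ?_)
  filter_upwards [hmin', hmax] with t h1 h2
  simpa using le_antisymm h2 h1

end Lines

/-! ### Smoothness of the closest point function -/

section Smooth

variable {d k : ℕ} {S Ω : Set (EuclideanSpace ℝ (Fin d))} {U : Set (EuclideanSpace ℝ (Fin k))}
  {φ : EuclideanSpace ℝ (Fin k) → EuclideanSpace ℝ (Fin d)}
  {x : EuclideanSpace ℝ (Fin d)} {y : EuclideanSpace ℝ (Fin k)}

lemma IsLocalParam.contDiffAt (hφ : IsLocalParam S U φ) (hy : y ∈ U) : ContDiffAt ℝ ∞ φ y :=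
  hφ.contDiffOn.contDiffAt (hφ.isOpen.mem_nhds hy)

lemma IsLocalParam.mem (hφ : IsLocalParam S U φ) (hy : y ∈ U) : φ y ∈ S := by
  obtain ⟨V, -, h⟩ := hφ.image_eq
  exact (h.le (mem_image_of_mem φ hy)).1

/-- The derivative in `y` of `½ ‖φ y - x‖²`, as a function of the pair `(x, y)`. It vanishes exactly
when `x - φ y` is normal to the surface at `φ y`. -/
noncomputable def normalEquation (φ : EuclideanSpace ℝ (Fin k) → EuclideanSpace ℝ (Fin d))
    (z : EuclideanSpace ℝ (Fin d) × EuclideanSpace ℝ (Fin k)) :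
    EuclideanSpace ℝ (Fin k) →L[ℝ] ℝ :=
  (innerSL ℝ (φ z.2 - z.1)).comp (fderiv ℝ φ z.2)

lemma normalEquation_apply (z : EuclideanSpace ℝ (Fin d) × EuclideanSpace ℝ (Fin k))
    (v : EuclideanSpace ℝ (Fin k)) :
    normalEquation φ z v = inner ℝ (φ z.2 - z.1) (fderiv ℝ φ z.2 v) := rfl

lemma hasFDerivAt_half_dist_sq (hφ : DifferentiableAt ℝ φ y) :
    HasFDerivAt (fun y => (1 / 2 : ℝ) * ‖φ y - x‖ ^ 2) (normalEquation φ (x, y)) y := by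
  convert! ((hφ.hasFDerivAt.sub_const x).norm_sq).const_mul (1 / 2 : ℝ) using 1
  ext v
  simp [normalEquation_apply, inner_sub_left]

lemma contDiffAt_normalEquation (hφ : ContDiffAt ℝ ∞ φ y) :
    ContDiffAt ℝ ∞ (normalEquation φ) (x, y) := by
  have h2 : ContDiffAt ℝ ∞ (fun z : EuclideanSpace ℝ (Fin d) × EuclideanSpace ℝ (Fin k) => φ z.2)
      (x, y) := ContDiffAt.comp (x, y) hφ contDiffAt_snd
  have h3 : ContDiffAt ℝ ∞
      (fun z : EuclideanSpace ℝ (Fin d) × EuclideanSpace ℝ (Fin k) => fderiv ℝ φ z.2) (x, y) :=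
    ContDiffAt.comp (x, y) (hφ.fderiv_right (m := ∞) (by simp)) contDiffAt_snd
  exact ((innerSL ℝ).contDiff.contDiffAt.comp (x, y) (h2.sub contDiffAt_fst)).clm_comp h3

lemma fderiv_normalEquation_apply (hφ : ContDiffAt ℝ ∞ φ y) (v w : EuclideanSpace ℝ (Fin k)) :
    fderiv ℝ (fun y => normalEquation φ (x, y)) y v w =
      inner ℝ (fderiv ℝ φ y v) (fderiv ℝ φ y w) +
        inner ℝ (φ y - x) (fderiv ℝ (fderiv ℝ φ) y v w) := by
  have h1 : HasFDerivAt φ (fderiv ℝ φ y) y := (hφ.differentiableAt (by simp)).hasFDerivAt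
  have h2 : HasFDerivAt (fderiv ℝ φ) (fderiv ℝ (fderiv ℝ φ) y) y :=
    ((hφ.fderiv_right (m := ∞) (by simp)).differentiableAt (by simp)).hasFDerivAt
  have h3 : HasFDerivAt (fun y => innerSL ℝ (φ y - x)) ((innerSL ℝ).comp (fderiv ℝ φ y)) y :=
    (innerSL ℝ).hasFDerivAt.comp y (h1.sub_const x)
  have h4 := (h3.clm_comp h2).fderiv
  change fderiv ℝ (fun y => (innerSL ℝ (φ y - x)).comp (fderiv ℝ φ y)) y v w = _
  rw [h4]
  simp [add_comm, inner_sub_left]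

lemma IsLocalParam.isLocalMin_of_isClosestPoint (hφ : IsLocalParam S U φ) (hy : y ∈ U)
    (h : IsClosestPoint S x (φ y)) : IsLocalMin (fun y => (1 / 2 : ℝ) * ‖φ y - x‖ ^ 2) y := by
  filter_upwards [hφ.isOpen.mem_nhds hy] with z hz
  have := h.2 _ (hφ.mem hz)
  rw [dist_comm x, dist_comm x, dist_eq_norm, dist_eq_norm] at this
  gcongr

lemma IsLocalParam.normalEquation_eq_zero (hφ : IsLocalParam S U φ) (hy : y ∈ U)
    (h : IsClosestPoint S x (φ y)) : normalEquation φ (x, y) = 0 :=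
  (hφ.isLocalMin_of_isClosestPoint hy h).hasFDerivAt_eq_zero
    (hasFDerivAt_half_dist_sq ((hφ.contDiffAt hy).differentiableAt (by simp)))

lemma IsLocalParam.fderiv_normalEquation_nonneg (hφ : IsLocalParam S U φ) (hy : y ∈ U)
    (h : IsClosestPoint S x (φ y)) (v : EuclideanSpace ℝ (Fin k)) :
    0 ≤ fderiv ℝ (fun y => normalEquation φ (x, y)) y v v := by
  have hC : ContDiffAt ℝ 2 (fun y => (1 / 2 : ℝ) * ‖φ y - x‖ ^ 2) y :=
    contDiffAt_const.mul ((((hφ.contDiffAt hy).of_le (WithTop.coe_le_coe.2 (le_top : (2 : ℕ∞) ≤ ⊤))).sub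
      contDiffAt_const).norm_sq ℝ)
  have hev : fderiv ℝ (fun y => (1 / 2 : ℝ) * ‖φ y - x‖ ^ 2) =ᶠ[𝓝 y]
      fun y => normalEquation φ (x, y) := by
    filter_upwards [hφ.isOpen.mem_nhds hy] with z hz
    exact (hasFDerivAt_half_dist_sq ((hφ.contDiffAt hz).differentiableAt (by simp))).fderiv
  rw [← hev.fderiv_eq]
  exact fderiv_fderiv_nonneg_of_isLocalMin hC (hφ.isLocalMin_of_isClosestPoint hy h) v

/-- The Hessian of `½ ‖φ y - x‖²` at the closest point is positive definite. It is affine in `x`, is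
the first fundamental form at `x = φ y`, and is positive semidefinite at a point `x₁` beyond `x`
that has the same closest point; at `x` it is therefore a convex combination with a positive share
of the first fundamental form. -/
lemma IsClosestPointNhd.fderiv_normalEquation_pos (hΩ : IsClosestPointNhd S Ω)
    (hφ : IsLocalParam S U φ) (hx : x ∈ Ω) (hy : y ∈ U) (hxy : cp S x = φ y)
    {v : EuclideanSpace ℝ (Fin k)} (hv : v ≠ 0) :
    0 < fderiv ℝ (fun y => normalEquation φ (x, y)) y v v := by
  obtain ⟨δ, hδ0, hδ1, x₁, hx₁, hxeq⟩ := hΩ.exists_prolongation hx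
  rw [hxy] at hx₁ hxeq
  have h1 := hφ.fderiv_normalEquation_nonneg hy hx₁ v
  rw [fderiv_normalEquation_apply (hφ.contDiffAt hy)] at h1 ⊢
  have h2 : φ y - x = (1 - δ) • (φ y - x₁) := by
    rw [hxeq]
    module
  have h3 : 0 < inner ℝ (fderiv ℝ φ y v) (fderiv ℝ φ y v) :=
    real_inner_self_pos.2 fun h =>
      hv (hφ.injective_fderiv y hy (h.trans (map_zero _).symm))
  rw [h2, real_inner_smul_left]
  nlinarith

lemma isInvertible_of_bilin_pos {B : EuclideanSpace ℝ (Fin k) →L[ℝ] EuclideanSpace ℝ (Fin k) →L[ℝ] ℝ}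
    (hB : ∀ v, v ≠ 0 → 0 < B v v) : B.IsInvertible := by
  have hinj : Function.Injective B := by
    refine (injective_iff_map_eq_zero B).2 fun v hv => ?_
    by_contra h
    simpa [hv] using hB v h
  have hrank : Module.finrank ℝ (EuclideanSpace ℝ (Fin k)) =
      Module.finrank ℝ (EuclideanSpace ℝ (Fin k) →L[ℝ] ℝ) := by
    rw [← (LinearMap.toContinuousLinearMap (𝕜 := ℝ) (E := EuclideanSpace ℝ (Fin k))
      (F' := ℝ)).finrank_eq]
    exact Subspace.dual_finrank_eq.symm
  exact ⟨(LinearEquiv.ofInjectiveOfFinrankEq B.toLinearMap hinj hrank).toContinuousLinearEquiv,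
    by ext; rfl⟩

/-- Near a point `x` of `Ω` the closest point, read in a parametrization `φ`, is a smooth function
`η`; moreover `η` gives the only solutions of the normal equation near `(x, y)`. -/
theorem IsClosestPointNhd.exists_contDiffAt_coordinate (hΩ : IsClosestPointNhd S Ω)
    (hφ : IsLocalParam S U φ) (hx : x ∈ Ω) (hy : y ∈ U) (hxy : cp S x = φ y) :
    ∃ η : EuclideanSpace ℝ (Fin d) → EuclideanSpace ℝ (Fin k),
      ContDiffAt ℝ ∞ η x ∧ η x = y ∧
      (∀ᶠ z in 𝓝 (x, y), normalEquation φ z = 0 → η z.1 = z.2) ∧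
      ∀ᶠ x' in 𝓝 x, η x' ∈ U ∧ cp S x' = φ (η x') := by
  have hF : ContDiffAt ℝ ∞ (normalEquation φ) (x, y) := contDiffAt_normalEquation (hφ.contDiffAt hy)
  have hpart : fderiv ℝ (normalEquation φ) (x, y) ∘L .inr ℝ _ _ =
      fderiv ℝ (fun y => normalEquation φ (x, y)) y :=
    ((hF.differentiableAt (by simp)).hasFDerivAt.comp y
      (hasFDerivAt_prodMk_right x y)).fderiv.symm
  have hinv : (fderiv ℝ (normalEquation φ) (x, y) ∘L .inr ℝ _ _).IsInvertible := by
    rw [hpart]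
    exact isInvertible_of_bilin_pos fun v hv => hΩ.fderiv_normalEquation_pos hφ hx hy hxy hv
  have hzero : normalEquation φ (x, y) = 0 :=
    hφ.normalEquation_eq_zero hy (hxy ▸ hΩ.isClosestPoint_cp hx)
  have hne : (∞ : WithTop ℕ∞) ≠ 0 := by simp
  have hsol : ∀ᶠ z in 𝓝 (x, y), normalEquation φ z = 0 →
      hF.implicitFunction hne hinv z.1 = z.2 := by
    filter_upwards [hF.eventually_apply_eq_iff_implicitFunction hne hinv] with z hz h0
    exact hz.1 (h0.trans hzero.symm)
  refine ⟨hF.implicitFunction hne hinv, hF.contDiffAt_implicitFunction hne hinv,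
    hF.implicitFunction_apply_self hne hinv, hsol, ?_⟩
  have hcp : Tendsto (cp S) (𝓝 x) (𝓝 (φ y)) := hxy ▸ hΩ.continuousAt_cp hx
  obtain ⟨V, hV, hVeq⟩ := hφ.image_eq
  have hyV : φ y ∈ V := (hVeq.le (mem_image_of_mem φ hy)).2
  obtain ⟨A, hA, B, hB, hAB⟩ := mem_nhds_prod_iff.1 hsol
  -- As `φ` is an embedding, points of `U` mapped close to `φ y` are close to `y`.
  have hBW : ∃ W ∈ 𝓝 (φ y), ∀ z ∈ U, φ z ∈ W → z ∈ B := by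
    have h1 : (Subtype.val : U → _) ⁻¹' B ∈ 𝓝 (⟨y, hy⟩ : U) :=
      continuous_subtype_val.continuousAt.preimage_mem_nhds hB
    rw [hφ.isEmbedding.nhds_eq_comap] at h1
    obtain ⟨W, hW, h2⟩ := h1
    exact ⟨W, hW, fun z hz hzW => @h2 ⟨z, hz⟩ hzW⟩
  obtain ⟨W, hW, hWB⟩ := hBW
  filter_upwards [hΩ.isOpen.mem_nhds hx, hA, hcp hW, hcp (hV.mem_nhds hyV)] with x' h1 h2 h3 h4
  obtain ⟨z, hz, hzeq⟩ := hVeq.ge ⟨hΩ.cp_mem h1, h4⟩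
  have hzB : z ∈ B := hWB z hz (by rw [hzeq]; exact h3)
  have h5 := hAB (mk_mem_prod h2 hzB)
    (hφ.normalEquation_eq_zero hz (hzeq ▸ hΩ.isClosestPoint_cp h1))
  dsimp only at h5
  rw [h5]
  exact ⟨hz, hzeq.symm⟩

end Smooth

/-! ### Orthogonal projection in terms of the Gram matrix -/

section Projection

variable {d k : ℕ} {T : Fin k → EuclideanSpace ℝ (Fin d)}

/-- The orthogonal projection onto the span of a linearly independent family `T`, written with the
inverse of the Gram matrix. -/
noncomputable def gramProj (T : Fin k → EuclideanSpace ℝ (Fin d)) :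
    EuclideanSpace ℝ (Fin d) →ₗ[ℝ] EuclideanSpace ℝ (Fin d) :=
  ∑ i, ∑ j, (Matrix.gram ℝ T)⁻¹ i j • (innerₛₗ ℝ (T j)).smulRight (T i)

lemma gramProj_apply (v : EuclideanSpace ℝ (Fin d)) :
    gramProj T v = ∑ i, ∑ j, ((Matrix.gram ℝ T)⁻¹ i j * inner ℝ v (T j)) • T i := by
  simp [gramProj, LinearMap.sum_apply, smul_smul, real_inner_comm]

lemma gramProj_eq_zero {v : EuclideanSpace ℝ (Fin d)} (hv : ∀ i, inner ℝ v (T i) = 0) :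
    gramProj T v = 0 := by
  simp [gramProj_apply, hv]

lemma inner_gramProj_of_orthogonal (v : EuclideanSpace ℝ (Fin d)) {w : EuclideanSpace ℝ (Fin d)}
    (hw : ∀ i, inner ℝ w (T i) = 0) : inner ℝ w (gramProj T v) = 0 := by
  simp [gramProj_apply, inner_sum, real_inner_smul_right, hw]

lemma inner_sub_gramProj (hT : LinearIndependent ℝ T) (v : EuclideanSpace ℝ (Fin d)) (l : Fin k) :
    inner ℝ (v - gramProj T v) (T l) = 0 := by
  have hdet : IsUnit (Matrix.gram ℝ T).det :=
    (Matrix.det_gram_ne_zero_iff_linearIndependent.2 hT).isUnit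
  have h1 : ∀ j, ∑ i, (Matrix.gram ℝ T)⁻¹ i j * inner ℝ (T i) (T l) = if l = j then 1 else 0 := by
    intro j
    rw [← Matrix.one_apply, ← Matrix.mul_nonsing_inv _ hdet, Matrix.mul_apply]
    refine Finset.sum_congr rfl fun i _ => ?_
    rw [Matrix.gram_apply, real_inner_comm, mul_comm]
  rw [inner_sub_left, gramProj_apply, sub_eq_zero]
  simp_rw [sum_inner, real_inner_smul_left]
  rw [Finset.sum_comm]
  have h2 : ∀ j, ∑ i, (Matrix.gram ℝ T)⁻¹ i j * inner ℝ v (T j) * inner ℝ (T i) (T l) =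
      inner ℝ v (T j) * if l = j then 1 else 0 := by
    intro j
    rw [← h1 j, Finset.mul_sum]
    exact Finset.sum_congr rfl fun i _ => by ring
  simp [h2]

/-- The trace of an operator whose quadratic form vanishes on the orthogonal complement of the span
of `T` is the trace of its compression to the span. -/
lemma trace_eq_sum_gram (hT : LinearIndependent ℝ T)
    (A : EuclideanSpace ℝ (Fin d) →ₗ[ℝ] EuclideanSpace ℝ (Fin d))
    (hA : ∀ n, (∀ i, inner ℝ n (T i) = 0) → inner ℝ n (A n) = 0) :
    LinearMap.trace ℝ _ A =
      ∑ i, ∑ j, (Matrix.gram ℝ T)⁻¹ i j * inner ℝ (A (T i)) (T j) := by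
  set b := EuclideanSpace.basisFun (Fin d) ℝ
  set P := gramProj T
  set N := LinearMap.id - P with hN
  have hNT : ∀ v i, inner ℝ (N v) (T i) = 0 := fun v i => inner_sub_gramProj hT v i
  have hNN : N ∘ₗ N = N := by
    ext1 v
    simp [hN, LinearMap.sub_apply, P, gramProj_eq_zero (inner_sub_gramProj hT v)]
  have hNsymm : ∀ v w, inner ℝ v (N w) = inner ℝ (N v) w := by
    intro v w
    have h1 : inner ℝ (P v) (N w) = 0 :=
      (real_inner_comm _ _).trans (inner_gramProj_of_orthogonal v (hNT w))
    have h2 : inner ℝ (N v) (P w) = 0 := inner_gramProj_of_orthogonal w (hNT v)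
    have h3 : inner ℝ (N v) (N w) = inner ℝ v (N w) - inner ℝ (P v) (N w) := by
      rw [← inner_sub_left]; rfl
    have h4 : inner ℝ (N v) (N w) = inner ℝ (N v) w - inner ℝ (N v) (P w) := by
      rw [← inner_sub_right]; rfl
    linarith
  have hnormal : LinearMap.trace ℝ _ (A ∘ₗ N) = 0 := by
    rw [← hNN, ← LinearMap.comp_assoc, LinearMap.trace_comp_comm', LinearMap.trace_eq_sum_inner _ b]
    refine Finset.sum_eq_zero fun i _ => ?_
    rw [LinearMap.comp_apply, hNsymm]
    exact hA _ (hNT _)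
  have hsplit : A = A ∘ₗ P + A ∘ₗ N := by
    ext1 v
    simp [hN]
  rw [hsplit, map_add, hnormal, add_zero, LinearMap.trace_eq_sum_inner _ b, ← hsplit]
  simp only [LinearMap.comp_apply, P, gramProj_apply, map_sum, map_smul, inner_sum,
    real_inner_smul_right]
  rw [Finset.sum_comm]
  refine Finset.sum_congr rfl fun i _ => ?_
  rw [Finset.sum_comm]
  refine Finset.sum_congr rfl fun j _ => ?_
  rw [← b.sum_inner_mul_inner (A (T i)) (T j), Finset.mul_sum]
  refine Finset.sum_congr rfl fun l _ => ?_
  rw [real_inner_comm (A (T i)) (b l)]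
  ring

end Projection

/-! ### The Laplacian of a closest point extension -/

section Laplacian

variable {d k : ℕ} {S Ω : Set (EuclideanSpace ℝ (Fin d))} {U : Set (EuclideanSpace ℝ (Fin k))}
  {φ : EuclideanSpace ℝ (Fin k) → EuclideanSpace ℝ (Fin d)}
  {x n : EuclideanSpace ℝ (Fin d)} {y : EuclideanSpace ℝ (Fin k)}
  {f u : EuclideanSpace ℝ (Fin d) → ℝ}

lemma IsLocalParam.linearIndependent (hφ : IsLocalParam S U φ) (hy : y ∈ U) :
    LinearIndependent ℝ fun i => partialDeriv i φ y := by
  have h := (EuclideanSpace.basisFun (Fin k) ℝ).toBasis.linearIndependent.map'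
    (fderiv ℝ φ y).toLinearMap (LinearMap.ker_eq_bot.2 (hφ.injective_fderiv y hy))
  convert! h using 2 with i
  simp [partialDeriv]

lemma inner_fderiv_eq_zero (hn : ∀ i, inner ℝ n (partialDeriv i φ y) = 0)
    (v : EuclideanSpace ℝ (Fin k)) : inner ℝ n (fderiv ℝ φ y v) = 0 := by
  rw [← (EuclideanSpace.basisFun (Fin k) ℝ).sum_repr v]
  simp only [map_sum, map_smul, inner_sum, real_inner_smul_right]
  refine Finset.sum_eq_zero fun i _ => ?_
  have := hn i
  rw [partialDeriv] at this
  simp [this]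

/-- Near the surface the closest point function is constant along normal lines, because points of
the normal line at `φ y` satisfy the normal equation with parameter `y`. -/
lemma IsClosestPointNhd.eventually_cp_normal (hΩ : IsClosestPointNhd S Ω)
    (hφ : IsLocalParam S U φ) (hy : y ∈ U) (hn : ∀ i, inner ℝ n (partialDeriv i φ y) = 0) :
    ∀ᶠ t : ℝ in 𝓝 0, cp S (φ y + t • n) = φ y := by
  have hS := hφ.mem hy
  obtain ⟨η, -, -, hsol, hη⟩ :=
    hΩ.exists_contDiffAt_coordinate hφ (hΩ.subset hS) hy (hΩ.cp_of_mem hS)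
  have hl := tendsto_line (φ y) n
  filter_upwards [(hl.prodMk_nhds tendsto_const_nhds).eventually hsol, hl.eventually hη]
    with t h1 h2
  have h3 : η (φ y + t • n) = y := h1 <| by
    ext v
    simp [normalEquation_apply, inner_neg_left, real_inner_smul_left, inner_fderiv_eq_zero hn]
  rw [h2.2, h3]

lemma IsClosestPointNhd.eventually_eq_of_normal (hΩ : IsClosestPointNhd S Ω)
    (hφ : IsLocalParam S U φ) (hy : y ∈ U) (hfc : ∀ x ∈ Ω, f (cp S x) = f x)
    (hn : ∀ i, inner ℝ n (partialDeriv i φ y) = 0) :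
    ∀ᶠ t : ℝ in 𝓝 0, f (φ y + t • n) = f (φ y) := by
  have hΩy := hΩ.isOpen.mem_nhds (hΩ.subset (hφ.mem hy))
  filter_upwards [hΩ.eventually_cp_normal hφ hy hn, tendsto_line (φ y) n hΩy] with t h1 h2
  rw [← hfc _ h2, h1]

/-- The Riesz isomorphism of Euclidean space as a real-linear map. -/
lemma exists_riesz (d : ℕ) : ∃ L : (EuclideanSpace ℝ (Fin d) →L[ℝ] ℝ) →L[ℝ] EuclideanSpace ℝ (Fin d),
    ∀ ℓ w, inner ℝ (L ℓ) w = ℓ w :=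
  ⟨⟨⟨⟨(InnerProductSpace.toDual ℝ _).symm, map_add _⟩, fun c ℓ => by simp⟩,
    (InnerProductSpace.toDual ℝ _).symm.continuous⟩, fun ℓ w => by simp⟩

/-- The Euclidean Laplacian of a function that is constant along the fibres of `cp` is, on `S`, the
Laplace-Beltrami operator of its restriction. Along `S` the gradient of `f` is tangential, so it
equals the surface gradient; and the Hessian of `f` vanishes on normal vectors, so its full trace
equals its tangential trace, which is the surface divergence of the gradient. -/
theorem IsClosestPointNhd.laplacian_eq_laplaceBeltrami (hΩ : IsClosestPointNhd S Ω)
    (hφ : IsLocalParam S U φ) (hy : y ∈ U) (hf : ContDiffOn ℝ 2 f Ω)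
    (hfc : ∀ x ∈ Ω, f (cp S x) = f x) (hu : EqOn u f S) :
    Δ f (φ y) = laplaceBeltrami φ u y := by
  obtain ⟨L, hL⟩ := exists_riesz d
  have hfC : ∀ z ∈ U, ContDiffAt ℝ 2 f (φ z) := fun z hz =>
    hf.contDiffAt (hΩ.isOpen.mem_nhds (hΩ.subset (hφ.mem hz)))
  have hφd : ∀ z ∈ U, DifferentiableAt ℝ φ z := fun z hz =>
    (hφ.contDiffAt hz).differentiableAt (by simp)
  have hgrad : ∀ z ∈ U, surfaceGradient φ u z = L (fderiv ℝ f (φ z)) := by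
    intro z hz
    have hT := hφ.linearIndependent hz
    have h1 : surfaceGradient φ u z =
        gramProj (fun i => partialDeriv i φ z) (L (fderiv ℝ f (φ z))) := by
      rw [gramProj_apply, surfaceGradient]
      refine Finset.sum_congr rfl fun i _ => Finset.sum_congr rfl fun j _ => ?_
      have hev : u ∘ φ =ᶠ[𝓝 z] f ∘ φ := by
        filter_upwards [hφ.isOpen.mem_nhds hz] with w hw using hu (hφ.mem hw)
      have h2 : partialDeriv j (u ∘ φ) z = fderiv ℝ f (φ z) (partialDeriv j φ z) := by
        rw [partialDeriv, hev.fderiv_eq,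
          fderiv_comp z ((hfC z hz).differentiableAt (by norm_num)) (hφd z hz)]
        rfl
      rw [h2, hL]
      rfl
    set w := L (fderiv ℝ f (φ z)) with hw
    have hperp := inner_sub_gramProj hT w
    have h3 : inner ℝ w (w - gramProj (fun i => partialDeriv i φ z) w) = 0 := by
      rw [hw, hL]
      exact fderiv_apply_eq_zero_of_line (hfC z hz)
        (hΩ.eventually_eq_of_normal hφ hz hfc hperp)
    have h4 := inner_gramProj_of_orthogonal w hperp
    have h5 : w - gramProj (fun i => partialDeriv i φ z) w = 0 := by
      rw [← inner_self_eq_zero (𝕜 := ℝ), inner_sub_right, h4, real_inner_comm, h3, sub_zero]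
    rw [h1, ← sub_eq_zero.1 h5]
  have hD : HasFDerivAt (fun z => L (fderiv ℝ f (φ z)))
      ((L ∘L fderiv ℝ (fderiv ℝ f) (φ y)) ∘L fderiv ℝ φ y) y := by
    have h1 : HasFDerivAt (fderiv ℝ f) (fderiv ℝ (fderiv ℝ f) (φ y)) (φ y) :=
      (((hfC y hy).fderiv_right (m := 1) (by norm_num)).differentiableAt (by norm_num)).hasFDerivAt
    exact (L.hasFDerivAt.comp _ h1).comp y (hφd y hy).hasFDerivAt
  have hpd : ∀ i, partialDeriv i (surfaceGradient φ u) y =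
      (L ∘L fderiv ℝ (fderiv ℝ f) (φ y)) (partialDeriv i φ y) := by
    intro i
    have hev : surfaceGradient φ u =ᶠ[𝓝 y] fun z => L (fderiv ℝ f (φ z)) := by
      filter_upwards [hφ.isOpen.mem_nhds hy] with z hz using hgrad z hz
    rw [partialDeriv, hev.fderiv_eq, hD.fderiv]
    rfl
  have htrace := trace_eq_sum_gram (hφ.linearIndependent hy)
    (L ∘L fderiv ℝ (fderiv ℝ f) (φ y)).toLinearMap fun n hn => by
      rw [real_inner_comm]
      exact (hL _ _).trans (fderiv_fderiv_apply_eq_zero_of_line (hfC y hy)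
        (hΩ.eventually_eq_of_normal hφ hy hfc hn))
  rw [laplaceBeltrami, surfaceDivergence,
    congrFun (InnerProductSpace.laplacian_eq_iteratedFDeriv_orthonormalBasis f
      (EuclideanSpace.basisFun (Fin d) ℝ)) (φ y)]
  simp only [hpd]
  refine Eq.trans ?_ htrace
  rw [LinearMap.trace_eq_sum_inner _ (EuclideanSpace.basisFun (Fin d) ℝ)]
  refine Finset.sum_congr rfl fun i _ => ?_
  rw [iteratedFDeriv_two_apply, real_inner_comm]
  exact (hL _ _).symm

lemma IsClosestPointNhd.cp_cp (hΩ : IsClosestPointNhd S Ω) (hx : x ∈ Ω) :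
    cp S (cp S x) = cp S x :=
  hΩ.cp_of_mem (hΩ.cp_mem hx)

lemma IsClosestPointNhd.laplacian_comp_cp_eq (hΩ : IsClosestPointNhd S Ω)
    (hφ : IsLocalParam S U φ) (hy : y ∈ U) (hu : ContDiffOn ℝ 2 (u ∘ cp S) Ω) :
    Δ (u ∘ cp S) (φ y) = laplaceBeltrami φ u y :=
  hΩ.laplacian_eq_laplaceBeltrami hφ hy hu
    (fun x hx => by simp [hΩ.cp_cp hx]) fun s hs => by simp [hΩ.cp_of_mem hs]

lemma IsClosestPointNhd.contDiffOn_comp_cp (hΩ : IsClosestPointNhd S Ω) (hS : IsSmoothSurface k S)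
    (hu : IsC2On k S u) : ContDiffOn ℝ 2 (u ∘ cp S) Ω := by
  intro x hx
  obtain ⟨U, φ, hφ, y, hy, hyx⟩ := hS _ (hΩ.cp_mem hx)
  obtain ⟨η, hηC, hηx, -, hη⟩ := hΩ.exists_contDiffAt_coordinate hφ hx hy hyx.symm
  have h1 : ContDiffAt ℝ 2 (u ∘ φ) (η x) := by
    rw [hηx]
    exact (hu U φ hφ).contDiffAt (hφ.isOpen.mem_nhds hy)
  have h2 : ContDiffAt ℝ 2 η x := hηC.of_le (WithTop.coe_le_coe.2 (le_top : (2 : ℕ∞) ≤ ⊤))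
  refine ((h1.comp x h2).congr_of_eventuallyEq ?_).contDiffWithinAt
  filter_upwards [hη] with z hz
  simp [hz.2]

/-- Conversely, `u` is of class `C²` on `S` as soon as its closest point extension is. -/
lemma IsClosestPointNhd.isC2On (hΩ : IsClosestPointNhd S Ω) (hu : ContDiffOn ℝ 2 (u ∘ cp S) Ω) :
    IsC2On k S u := by
  intro U φ hφ
  have h1 : ContDiffOn ℝ 2 ((u ∘ cp S) ∘ φ) U :=
    hu.comp (hφ.contDiffOn.of_le (WithTop.coe_le_coe.2 (le_top : (2 : ℕ∞) ≤ ⊤)))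
      fun y hy => hΩ.subset (hφ.mem hy)
  exact h1.congr fun y hy => by simp [hΩ.cp_of_mem (hφ.mem hy)]

lemma IsClosestPointNhd.laplacian_comp_cp_congr (hΩ : IsClosestPointNhd S Ω)
    {v : EuclideanSpace ℝ (Fin d) → ℝ} (h : EqOn v u S) (hx : x ∈ Ω) :
    Δ (v ∘ cp S) x = Δ (u ∘ cp S) x := by
  refine (InnerProductSpace.laplacian_congr_nhds ?_).self_of_nhds
  filter_upwards [hΩ.isOpen.mem_nhds hx] with z hz using h (hΩ.cp_mem hz)

end Laplacian

end ClosestPointMethod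

/-! ### The eigenvalue problems -/

theorem theorem2 (d k : ℕ) (S Ω : Set (EuclideanSpace ℝ (Fin d)))
    (hS : ClosestPointMethod.IsSmoothSurface k S)
    (hΩ : ClosestPointMethod.IsClosestPointNhd S Ω)
    (ε : ℝ) (hε : 0 < ε) :
    (∀ (lam : ℝ) (u : EuclideanSpace ℝ (Fin d) → ℝ),
      lam < 2 * (d : ℝ) / ε ^ 2 →
      ClosestPointMethod.IsLBEigenfunction k S lam u →
      ∃ v : EuclideanSpace ℝ (Fin d) → ℝ,
        ClosestPointMethod.IsRegEigenfunction S Ω ε lam v ∧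
        Set.EqOn v u S ∧
        (∀ v' : EuclideanSpace ℝ (Fin d) → ℝ,
          ClosestPointMethod.IsRegEigenfunction S Ω ε lam v' →
          Set.EqOn v' u S → Set.EqOn v' v Ω) ∧
        ∀ x ∈ Ω, v x =
          (Δ (u ∘ ClosestPointMethod.cp S) x
            + 2 * (d : ℝ) / ε ^ 2 * u (ClosestPointMethod.cp S x))
          / (-lam + 2 * (d : ℝ) / ε ^ 2)) ∧
    (∀ (lam : ℝ) (v : EuclideanSpace ℝ (Fin d) → ℝ),
      ClosestPointMethod.IsRegEigenfunction S Ω ε lam v →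
      ClosestPointMethod.IsLBSolution k S lam v ∧
      (lam ≠ 2 * (d : ℝ) / ε ^ 2 → ClosestPointMethod.IsLBEigenfunction k S lam v)) := by
  have hLB : ∀ {lam : ℝ} {u : EuclideanSpace ℝ (Fin d) → ℝ},
      ClosestPointMethod.IsLBSolution k S lam u → ∀ s ∈ S,
      Δ (u ∘ ClosestPointMethod.cp S) s = -(lam * u s) := by
    intro lam u hu s hs
    obtain ⟨U, φ, hφ, y, hy, rfl⟩ := hS s hs
    rw [hΩ.laplacian_comp_cp_eq hφ hy (hΩ.contDiffOn_comp_cp hS hu.isC2On), ← hu.eq U φ hφ y hy,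
      neg_neg]
  refine ⟨fun lam u hlam hu => ?_, fun lam v hv => ?_⟩
  · have hc : -lam + 2 * (d : ℝ) / ε ^ 2 ≠ 0 := by linarith
    set c : ℝ := 2 * (d : ℝ) / ε ^ 2 with hcdef
    set v : EuclideanSpace ℝ (Fin d) → ℝ := fun x =>
      (Δ (u ∘ ClosestPointMethod.cp S) x + c * u (ClosestPointMethod.cp S x)) / (-lam + c) with hv
    have hvu : Set.EqOn v u S := by
      intro s hs
      simp only [hv, hLB hu.toIsLBSolution s hs, hΩ.cp_of_mem hs]
      rw [div_eq_iff hc]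
      ring
    refine ⟨v, ⟨?_, fun x hx => ?_, ?_⟩, hvu, fun v' hv' hv'u x hx => ?_, fun x _ => rfl⟩
    · exact (hΩ.contDiffOn_comp_cp hS hu.isC2On).congr fun x hx => hvu (hΩ.cp_mem hx)
    · have h1 : v x * (-lam + c) =
          Δ (u ∘ ClosestPointMethod.cp S) x + c * u (ClosestPointMethod.cp S x) :=
        div_mul_cancel₀ _ hc
      rw [ClosestPointMethod.lapSharp, hΩ.laplacian_comp_cp_congr hvu hx, hvu (hΩ.cp_mem hx)]
      linarith
    · obtain ⟨s, hs, hne⟩ := hu.ne_zero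
      exact ⟨s, hΩ.subset hs, by rwa [hvu hs]⟩
    · have h1 := hv'.eq x hx
      rw [ClosestPointMethod.lapSharp, hΩ.laplacian_comp_cp_congr hv'u hx,
        hv'u (hΩ.cp_mem hx)] at h1
      simp only [hv]
      rw [eq_div_iff hc]
      linarith
  · have hsol : ClosestPointMethod.IsLBSolution k S lam v := by
      refine ⟨hΩ.isC2On hv.contDiffOn, fun U φ hφ y hy => ?_⟩
      have h1 := hv.eq (φ y) (hΩ.subset (hφ.mem hy))
      rw [ClosestPointMethod.lapSharp, hΩ.laplacian_comp_cp_eq hφ hy hv.contDiffOn,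
        hΩ.cp_of_mem (hφ.mem hy)] at h1
      linarith
    refine ⟨hsol, fun hlam => ⟨hsol, ?_⟩⟩
    by_contra! h0
    obtain ⟨x, hx, hne⟩ := hv.ne_zero
    have h1 := hv.eq x hx
    -- If `v` vanishes on `S`, its closest point extension vanishes, and the equation at `x` becomes
    -- `(2d/ε²) v x = lam v x`.
    rw [ClosestPointMethod.lapSharp,
      hΩ.laplacian_comp_cp_congr (u := fun _ => (0 : ℝ)) (fun s hs => h0 s hs) hx,
      h0 _ (hΩ.cp_mem hx)] at h1
    have h2 : Δ ((fun _ => (0 : ℝ)) ∘ ClosestPointMethod.cp S) x = 0 := by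
      simp [Function.comp_def, InnerProductSpace.laplacian_const]
    rw [h2] at h1
    exact hlam (mul_right_cancel₀ hne (by linarith))
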